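/- Let $n\ge 2$, $0<s<1$ and $1\le p<\infty$ with $sp<n$, put $p^*_s:=\frac{np}{n-sp}$, and let $1\le r<\min\{p^*_s,q\}\le\max\{p^*_s,q\}<\infty$. Write $[u]_{s,p}:=\bigl(\iint_{\mathbb R^n\times\mathbb R^n}\frac{|u(x)-u(y)|^p}{|x-y|^{n+sp}}\,dx\,dy\bigr)^{1/p}$, and for a measurable weight $W\ge 0$ and $1\le a<\infty$ let $L^a(W;\mathbb R^n)$ be the space of measurable functions with norm $\|u\|_{L^a(W)}:=\bigl(\int_{\mathbb R^n}|u|^a W\,dx\bigr)^{1/a}<\infty$. Let $K:\mathbb R^n\to(0,\infty)$ be Lebesgue measurable with $K\in L^t_{loc}(\mathbb R^n)$ for some $t\in\bigl(\frac{\max\{p^*_s,q\}}{\max\{p^*_s,q\}-r},\infty\bigr]$. (a) Let $V:\mathbb R^n\to(0,\infty)$ be Lebesgue measurable with $\inf_D V>0$ for every compact $D\subset\mathbb R^n$, and let $M_V^{s;q,p}(\mathbb R^n)$ be the completion of $C_c^1(\mathbb R^n)$ with respect to the norm $\|u\|_{L^q(V)}+[u]_{s,p}$ (of the functions in $C^1_c(\mathbb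 R^n)$ with finite norm, if $V$ is not locally integrable), regarded as a space of functions. If $K^{\psi(\tau)}V^{-\tau}\in L^1(\mathbb R^n)$ for some $\tau\in\bigl[0,\frac{r}{q-r}\bigr]$, where $\psi(\tau):=\frac{p^*_s+\tau(p^*_s-q)}{p^*_s-r}$, then $M_V^{s;q,p}(\mathbb R^n)$ embeds compactly into $L^r(K;\mathbb R^n)$. (b) (The case $V\equiv 0$, $\tau=0$.) Let $D^{s,p}(\mathbb R^n)$ be the space of functions $u\in L^1_{loc}(\mathbb R^n)$ with $[u]_{s,p}<\infty$ such that $\{|u|\ge c\}$ has finite Lebesgue measure for every $c>0$, normed by $[\cdot]_{s,p}$. If $K^{p^*_s/(p^*_s-r)}\in L^1(\mathbb R^n)$, then $D^{s,p}(\mathbb R^n)$ embeds compactly into $L^r(K;\mathbb R^n)$. -/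

import Mathlib

open MeasureTheory Filter Topology
open scoped ENNReal NNReal

noncomputable section

namespace FracSobolev

/-- The Euclidean space `ℝⁿ`, with its Lebesgue measure. -/
abbrev E (n : ℕ) : Type := EuclideanSpace ℝ (Fin n)

/-- The fractional critical exponent `p*_s = n p / (n - s p)` (used only for `s p < n`). -/
def pstar (n : ℕ) (s p : ℝ) : ℝ := (n : ℝ) * p / ((n : ℝ) - s * p)

/-- The exponent `ψ(τ) = (p*_s + τ (p*_s - q)) / (p*_s - r)`. -/
def psi (n : ℕ) (s p q r τ : ℝ) : ℝ :=
  (pstar n s p + τ * (pstar n s p - q)) / (pstar n s p - r)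

/-- The weighted norm `(∫ |u|^q V dx)^(1/q)`, as an extended nonnegative number. -/
def wnorm {n : ℕ} (q : ℝ) (V : E n → ℝ) (u : E n → ℝ) : ℝ≥0∞ :=
  (∫⁻ x, ‖u x‖ₑ ^ q * ENNReal.ofReal (V x)) ^ (1 / q)

/-- The Gagliardo seminorm
`[u]_{s,p} = (∬ |u(x) - u(y)|^p / |x - y|^(n + s p) dx dy)^(1/p)`,
as an extended nonnegative number. -/
def gagliardo {n : ℕ} (s p : ℝ) (u : E n → ℝ) : ℝ≥0∞ :=
  (∫⁻ z : E n × E n, ‖u z.1 - u z.2‖ₑ ^ p / ‖z.1 - z.2‖ₑ ^ ((n : ℝ) + s * p)) ^ (1 / p)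

/-- The norm `(∫ |u|^q V dx)^(1/q) + [u]_{s,p}`. -/
def normMV {n : ℕ} (s q p : ℝ) (V : E n → ℝ) (u : E n → ℝ) : ℝ≥0∞ :=
  wnorm q V u + gagliardo s p u

/-- `M_V^{s;q,p}(ℝⁿ)`, the completion of `C_c^1(ℝⁿ)` for the norm `normMV s q p V`, realised as a
space of (Lebesgue measurable) functions: the closure of `C_c^1(ℝⁿ)` among the measurable functions
of finite norm. For `V > 0` that ambient normed space is complete (Fatou), and a limit in norm is
determined almost everywhere by its `L^q(V)` part, so this is the completion. If `V` is not locally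
integrable, only the functions of `C_c^1(ℝⁿ)` of finite norm play a role. -/
def spaceMV {n : ℕ} (s q p : ℝ) (V : E n → ℝ) : Set (E n → ℝ) :=
  {u | AEMeasurable u ∧ normMV s q p V u < ∞ ∧
    ∃ φ : ℕ → E n → ℝ, (∀ k, ContDiff ℝ 1 (φ k) ∧ HasCompactSupport (φ k)) ∧
      Tendsto (fun k => normMV s q p V (fun x => φ k x - u x)) atTop (𝓝 0)}

/-- `u` vanishes at infinity: `{|u| ≥ c}` has finite Lebesgue measure for each `c > 0`. -/
def VanishesAtInfinity {n : ℕ} (u : E n → ℝ) : Prop :=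
  ∀ c : ℝ, 0 < c → volume {x | c ≤ |u x|} < ∞

/-- `D^{s,p}(ℝⁿ)`: the locally integrable functions that vanish at infinity and have finite
Gagliardo seminorm; it is normed by that seminorm. -/
def spaceD (n : ℕ) (s p : ℝ) : Set (E n → ℝ) :=
  {u | LocallyIntegrable u ∧ VanishesAtInfinity u ∧ gagliardo s p u < ∞}

/-- `f ∈ L^t_loc(ℝⁿ)`. -/
def MemLpLoc {n : ℕ} (f : E n → ℝ) (t : ℝ≥0∞) : Prop :=
  ∀ D : Set (E n), IsCompact D → MemLp f t (volume.restrict D)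

/-- The function space `X` with norm `N` embeds compactly into `L^r(K; ℝⁿ)`: the inclusion is
well defined and bounded, and each sequence that is bounded in `X` has a subsequence that converges
in `L^r(K; ℝⁿ)` to an element of this space. -/
def CompactlyEmbedded {n : ℕ} (X : Set (E n → ℝ)) (N : (E n → ℝ) → ℝ≥0∞) (r : ℝ)
    (K : E n → ℝ) : Prop :=
  (∃ C : ℝ≥0, ∀ u ∈ X, wnorm r K u ≤ C * N u) ∧
  ∀ u : ℕ → E n → ℝ, (∀ k, u k ∈ X) → (∃ M : ℝ≥0, ∀ k, N (u k) ≤ M) →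
    ∃ v : E n → ℝ, AEMeasurable v ∧ wnorm r K v < ∞ ∧
      ∃ θ : ℕ → ℕ, StrictMono θ ∧
        Tendsto (fun k => wnorm r K (fun x => u (θ k) x - v x)) atTop (𝓝 0)

end FracSobolev

end

/-!
The argument rests on two facts, the fractional Sobolev inequality and a weak form of the
Rellich-Kondrachov theorem. A single pointwise estimate drives both: Jensen's inequality on the ball
`B` of radius `R` around `x` bounds the mean of `|u(x) - u(y)|` over `y ∈ B` by `C R^s g(x)`, where
`g(x)^p = ∫ |u(x) - u(y)|^p / |x - y|^(n + s p) dy`, so that `‖g‖_p = [u]` (`mean_enorm_sub_le`).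

*Sobolev.* The mean of `|u|` over `B` is at most `C R^(-n/p*) ‖u‖_{p*}`. Hence
`|u(x)| ≤ C (R^s g(x) + R^(-n/p*) ‖u‖_{p*})` for every `R`; the best `R` gives
`|u(x)|^{p*} ≤ C ‖u‖_{p*}^(p* - p) g(x)^p`, and integration yields `‖u‖_{p*} ≤ C [u]` as soon as
`‖u‖_{p*}` is finite (`exists_sobolev_of_ne_top`). Fatou's lemma removes this restriction: a
function of `M_V` is an almost everywhere limit of functions in `C_c^1` (`exists_sobolev_spaceMV`), and a
function vanishing at infinity is a limit of truncations (`exists_sobolev`).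

*Almost everywhere convergence.* Of a sequence bounded in `L^{p*}` and in the Gagliardo seminorm,
a subsequence has converging means over every ball, by weak compactness. As these means are within
`C R^s [u]` of the function in `L^p`, the subsequence is Cauchy in `L^p` of a finite measure
equivalent to Lebesgue measure, and a further subsequence converges almost everywhere
(`exists_subseq_ae_tendsto`).

*Conclusion.* With `H = K^ψ(τ) V^(-τ)`, Hölder's inequality with three factors bounds `∫_A |u|^r K`
by `(∫_A H)^(1/ψ(τ))` times the `r`-th power of the norm of `u`, for every measurable set `A`; the
condition `τ ≤ r / (q - r)` says that the third exponent is nonnegative (`psi_exponents`,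
`setLIntegral_le_norm`). The choice of the whole space for `A` gives the bounded embedding. Moreover
the functions `|u_k - v|^r K / H` are uniformly integrable for the finite measure `H dx`, so that by
Vitali's theorem almost everywhere convergence becomes convergence in `L^r(K)`
(`tendsto_wnorm_of_ae_tendsto`). The integrability of `H` over the whole space thereby excludes both
concentration and loss of mass at infinity. Part (b) is the case `τ = 0`, in which `V` disappears.
-/

namespace FracSobolev

/-! ### Pointwise Gagliardo energy and means over balls -/

/-- The pointwise Gagliardo energy `∫ |u(x) - u(y)|^p / |x - y|^(n + s p) dy`. -/
noncomputable def energyAt {n : ℕ} (s p : ℝ) (u : E n → ℝ) (x : E n) : ℝ≥0∞ :=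
  ∫⁻ y, ‖u x - u y‖ₑ ^ p / ‖x - y‖ₑ ^ ((n : ℝ) + s * p)

theorem aemeasurable_gagliardo_kernel {n : ℕ} (s p : ℝ) {u : E n → ℝ} (hu : AEMeasurable u) :
    AEMeasurable (fun z : E n × E n =>
      ‖u z.1 - u z.2‖ₑ ^ p / ‖z.1 - z.2‖ₑ ^ ((n : ℝ) + s * p))
      ((volume : Measure (E n)).prod volume) := by
  have h1 : AEMeasurable (fun z : E n × E n => u z.1) ((volume : Measure (E n)).prod volume) :=
    hu.comp_quasiMeasurePreserving Measure.quasiMeasurePreserving_fst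
  have h2 : AEMeasurable (fun z : E n × E n => u z.2) ((volume : Measure (E n)).prod volume) :=
    hu.comp_quasiMeasurePreserving Measure.quasiMeasurePreserving_snd
  have h3 : Measurable (fun z : E n × E n => ‖z.1 - z.2‖ₑ ^ ((n : ℝ) + s * p)) := by fun_prop
  exact ((h1.sub h2).enorm.pow_const p).div h3.aemeasurable

theorem lintegral_energyAt {n : ℕ} (s : ℝ) {p : ℝ} (hp : 0 < p) {u : E n → ℝ}
    (hu : AEMeasurable u) : ∫⁻ x, energyAt s p u x = gagliardo s p u ^ p := by
  unfold gagliardo energyAt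
  rw [← ENNReal.rpow_mul, one_div_mul_cancel hp.ne', ENNReal.rpow_one, Measure.volume_eq_prod,
    lintegral_prod _ (aemeasurable_gagliardo_kernel s p hu)]

/-- Jensen's inequality for the power `m ≥ 1`, on a set of finite positive measure. -/
theorem mean_enorm_le {α : Type*} [MeasurableSpace α] {μ : Measure α} {m : ℝ} (hm : 1 ≤ m)
    {f : α → ℝ} (hf : AEMeasurable f μ) {S : Set α} (h0 : μ S ≠ 0) (hS : μ S ≠ ∞) :
    (μ S)⁻¹ * ∫⁻ y in S, ‖f y‖ₑ ∂μ ≤ μ S ^ (-(1 / m)) * (∫⁻ y in S, ‖f y‖ₑ ^ m ∂μ) ^ (1 / m) := by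
  have h := eLpNorm'_le_eLpNorm'_mul_rpow_measure_univ (μ := μ.restrict S) (f := f)
    one_pos hm hf.aestronglyMeasurable.restrict
  simp only [eLpNorm', ENNReal.rpow_one, div_one, Measure.restrict_apply_univ] at h
  calc (μ S)⁻¹ * ∫⁻ y in S, ‖f y‖ₑ ∂μ
      ≤ (μ S)⁻¹ * ((∫⁻ y in S, ‖f y‖ₑ ^ m ∂μ) ^ (1 / m) * μ S ^ (1 - 1 / m)) := by gcongr
    _ = μ S ^ (-(1 / m)) * (∫⁻ y in S, ‖f y‖ₑ ^ m ∂μ) ^ (1 / m) := by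
        rw [← ENNReal.rpow_neg_one, mul_left_comm, ← ENNReal.rpow_add _ _ h0 hS, mul_comm]
        congr 2; ring

theorem volume_ball_pos_ne_top {n : ℕ} (x : E n) {R : ℝ} (hR : 0 < R) :
    volume (Metric.ball x R) ≠ 0 ∧ volume (Metric.ball x R) ≠ ∞ :=
  ⟨(Metric.measure_ball_pos _ _ hR).ne', measure_ball_lt_top.ne⟩

theorem volume_ball_rpow {n : ℕ} (hn : 0 < n) (x : E n) {R : ℝ} (hR : 0 < R) (a : ℝ) :
    volume (Metric.ball x R) ^ a =
      ENNReal.ofReal R ^ (n * a) * volume (Metric.ball (0 : E n) 1) ^ a := by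
  have : Nonempty (Fin n) := ⟨⟨0, hn⟩⟩
  obtain ⟨h0, h1⟩ := volume_ball_pos_ne_top (0 : E n) one_pos
  rw [Measure.addHaar_ball _ _ hR.le, finrank_euclideanSpace_fin, ENNReal.ofReal_pow hR.le,
    ENNReal.mul_rpow_of_ne_top (by finiteness) h1, ← ENNReal.rpow_natCast, ← ENNReal.rpow_mul]

/-- The mean oscillation of `u` around the value `u x` on the ball of radius `R` is controlled by
`R ^ s` times the pointwise Gagliardo energy. -/
theorem mean_enorm_sub_le {n : ℕ} (hn : 0 < n) {s p : ℝ} (hs : 0 < s) (hp : 1 ≤ p)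
    {u : E n → ℝ} (hu : AEMeasurable u) (x : E n) {R : ℝ} (hR : 0 < R) :
    (volume (Metric.ball x R))⁻¹ * ∫⁻ y in Metric.ball x R, ‖u x - u y‖ₑ ≤
      volume (Metric.ball (0 : E n) 1) ^ (-(1 / p)) * ENNReal.ofReal R ^ s *
        energyAt s p u x ^ (1 / p) := by
  have hp0 : 0 < p := by linarith
  obtain ⟨h0, h1⟩ := volume_ball_pos_ne_top x hR
  have hρ0 : ENNReal.ofReal R ≠ 0 := by simpa using hR
  set κ : ℝ := (n : ℝ) + s * p with hκ
  have hκ0 : 0 < κ := by positivity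
  have key : ∫⁻ y in Metric.ball x R, ‖u x - u y‖ₑ ^ p ≤
      ENNReal.ofReal R ^ κ * energyAt s p u x := by
    rw [energyAt, ← lintegral_const_mul' _ _ (by finiteness)]
    refine (setLIntegral_mono' measurableSet_ball fun y hy => ?_).trans
      (setLIntegral_le_lintegral _ _)
    by_cases hxy : x = y
    · subst hxy; simp [hp0]
    have hd : ‖x - y‖ₑ ≤ ENNReal.ofReal R := by
      rw [← ofReal_norm]
      refine ENNReal.ofReal_le_ofReal ?_
      rw [← dist_eq_norm, dist_comm]; exact (Metric.mem_ball.1 hy).le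
    have hd0 : ‖x - y‖ₑ ≠ 0 := by simpa [sub_eq_zero] using hxy
    have e0 : ‖x - y‖ₑ ^ κ ≠ 0 := by simp [hd0, ENNReal.rpow_eq_zero_iff]
    have e1 : ‖x - y‖ₑ ^ κ ≠ ∞ := by finiteness
    calc ‖u x - u y‖ₑ ^ p = ‖x - y‖ₑ ^ κ * (‖u x - u y‖ₑ ^ p / ‖x - y‖ₑ ^ κ) :=
          (ENNReal.mul_div_cancel e0 e1).symm
      _ ≤ _ := by gcongr
  have hf : AEMeasurable (fun y => u x - u y) := hu.const_sub _
  refine (mean_enorm_le hp hf h0 h1).trans ?_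
  calc volume (Metric.ball x R) ^ (-(1 / p)) *
        (∫⁻ y in Metric.ball x R, ‖u x - u y‖ₑ ^ p) ^ (1 / p)
      ≤ volume (Metric.ball x R) ^ (-(1 / p)) *
        (ENNReal.ofReal R ^ κ * energyAt s p u x) ^ (1 / p) := by gcongr
    _ = _ := by
        rw [volume_ball_rpow hn x hR, ENNReal.mul_rpow_of_nonneg _ _ (by positivity),
          ← ENNReal.rpow_mul]
        have : (ENNReal.ofReal R) ^ s = ENNReal.ofReal R ^ (n * (-(1 / p))) *
            ENNReal.ofReal R ^ (κ * (1 / p)) := by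
          rw [← ENNReal.rpow_add _ _ hρ0 (by finiteness), hκ]
          congr 1; field_simp; ring
        rw [this]; ring

/-- Hölder's inequality for the mean of `u` over a ball. -/
theorem mean_enorm_ball_le {n : ℕ} (hn : 0 < n) {m : ℝ} (hm : 1 ≤ m)
    {u : E n → ℝ} (hu : AEMeasurable u) (x : E n) {R : ℝ} (hR : 0 < R) :
    (volume (Metric.ball x R))⁻¹ * ∫⁻ y in Metric.ball x R, ‖u y‖ₑ ≤
      volume (Metric.ball (0 : E n) 1) ^ (-(1 / m)) * ENNReal.ofReal R ^ (-(n / m)) *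
        (∫⁻ y, ‖u y‖ₑ ^ m) ^ (1 / m) := by
  obtain ⟨h0, h1⟩ := volume_ball_pos_ne_top x hR
  refine (mean_enorm_le hm hu h0 h1).trans ?_
  rw [volume_ball_rpow hn x hR, mul_comm (ENNReal.ofReal R ^ _),
    show (n : ℝ) * (-(1 / m)) = -(n / m) by ring]
  gcongr
  exact Measure.restrict_le_self

/-- Interpolation between growing and decaying powers of a radius: this is the optimisation in `R`
behind Hedberg-type pointwise estimates. -/
theorem le_of_forall_radius {U G A C : ℝ≥0∞} (hC : C ≠ ∞) (hA : A ≠ ∞) (hA0 : A ≠ 0) {a b : ℝ}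
    (ha : 0 < a) (hb : 0 < b)
    (h : ∀ R : ℝ, 0 < R → U ≤ C * (ENNReal.ofReal R ^ a * G + ENNReal.ofReal R ^ (-b) * A)) :
    U ≤ 2 * C * (A ^ (a / (a + b)) * G ^ (b / (a + b))) := by
  have hab : 0 < a + b := by positivity
  rcases eq_or_ne G ∞ with rfl | hG
  · rcases eq_or_ne C 0 with rfl | hC0
    · simpa using h 1 one_pos
    rw [ENNReal.top_rpow_of_pos (by positivity), ENNReal.mul_top, ENNReal.mul_top]
    · exact le_top
    · simpa using hC0
    · simp [ENNReal.rpow_eq_zero_iff, hA0, hA]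
  rcases eq_or_ne G 0 with rfl | hG0
  · have hlim : Tendsto (fun R : ℝ => C * (ENNReal.ofReal (R ^ (-b)) * A)) atTop
        (𝓝 (C * (ENNReal.ofReal 0 * A))) :=
      ENNReal.Tendsto.const_mul (ENNReal.Tendsto.mul_const
        (ENNReal.tendsto_ofReal (tendsto_rpow_neg_atTop hb)) (Or.inr hA)) (Or.inr hC)
    simp only [ENNReal.ofReal_zero, zero_mul, mul_zero] at hlim
    refine (ge_of_tendsto hlim ?_).trans zero_le
    filter_upwards [eventually_gt_atTop 0] with R hR
    simpa [ENNReal.ofReal_rpow_of_pos hR] using h R hR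
  -- the two terms balance at the radius `(A / G) ^ (1 / (a + b))`
  lift G to ℝ≥0 using hG
  lift A to ℝ≥0 using hA
  have hG0' : 0 < G := by simpa [pos_iff_ne_zero] using hG0
  have hA0' : 0 < A := by simpa [pos_iff_ne_zero] using hA0
  set ρ : ℝ≥0 := (A / G) ^ (1 / (a + b)) with hρ
  have hρ0 : 0 < ρ := NNReal.rpow_pos (by positivity)
  have h1 := h ρ hρ0
  have e1 : ρ ^ a * G = A ^ (a / (a + b)) * G ^ (b / (a + b)) := by
    rw [hρ, ← NNReal.rpow_mul, NNReal.div_rpow, one_div_mul_eq_div,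
      show b / (a + b) = 1 - a / (a + b) by field_simp; ring,
      NNReal.rpow_sub hG0'.ne', NNReal.rpow_one]
    field_simp
  have e2 : ρ ^ (-b) * A = A ^ (a / (a + b)) * G ^ (b / (a + b)) := by
    rw [hρ, ← NNReal.rpow_mul, mul_neg, NNReal.rpow_neg, NNReal.div_rpow, one_div_mul_eq_div,
      show a / (a + b) = 1 - b / (a + b) by field_simp; ring,
      NNReal.rpow_sub hA0'.ne', NNReal.rpow_one]
    field_simp
  rw [ENNReal.ofReal_coe_nnreal, ← ENNReal.coe_rpow_of_ne_zero hρ0.ne',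
    ← ENNReal.coe_rpow_of_ne_zero hρ0.ne', ← ENNReal.coe_mul, ← ENNReal.coe_mul, e1, e2] at h1
  rw [← ENNReal.coe_rpow_of_ne_zero hA0'.ne', ← ENNReal.coe_rpow_of_ne_zero hG0'.ne',
    ← ENNReal.coe_mul]
  refine h1.trans (le_of_eq ?_)
  ring

/-! ### The fractional Sobolev inequality for functions in the critical space -/

theorem rpow_one_div_le_iff {a b : ℝ≥0∞} {m : ℝ} (hm : 0 < m) : a ^ (1 / m) ≤ b ↔ a ≤ b ^ m := by
  rw [← ENNReal.le_rpow_inv_iff (by positivity), one_div, inv_inv]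

theorem lt_pstar {n : ℕ} {s p : ℝ} (hs : 0 < s) (hp : 0 < p) (hsp : s * p < n) :
    p < pstar n s p := by
  rw [pstar, lt_div_iff₀ (by linarith)]
  nlinarith [mul_pos (mul_pos hs hp) hp]

theorem natCast_div_pstar {n : ℕ} (hn : 0 < n) (s p : ℝ) :
    (n : ℝ) / pstar n s p = (n - s * p) / p := by
  have : (0 : ℝ) < n := by exact_mod_cast hn
  rw [pstar, div_div_eq_mul_div, mul_div_mul_left _ _ this.ne']

/-- The fractional Sobolev inequality, for functions already known to lie in `L^{p*}`. -/
theorem exists_sobolev_of_ne_top {n : ℕ} (hn : 0 < n) {s p : ℝ} (hs : 0 < s) (hp : 1 ≤ p)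
    (hsp : s * p < n) :
    ∃ C : ℝ≥0, ∀ u : E n → ℝ, AEMeasurable u → ∫⁻ x, ‖u x‖ₑ ^ pstar n s p ≠ ∞ →
      (∫⁻ x, ‖u x‖ₑ ^ pstar n s p) ^ (1 / pstar n s p) ≤ C * gagliardo s p u := by
  have hp0 : 0 < p := by linarith
  have hn0 : (0 : ℝ) < n := by exact_mod_cast hn
  have hpm := lt_pstar hs hp0 hsp
  have hnm := natCast_div_pstar hn s p
  set m := pstar n s p with hm
  have hm0 : 0 < m := by linarith
  obtain ⟨hω0, hω1⟩ := volume_ball_pos_ne_top (0 : E n) one_pos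
  set ω := volume (Metric.ball (0 : E n) 1)
  set c : ℝ≥0∞ := max (ω ^ (-(1 / p))) (ω ^ (-(1 / m))) with hc
  have hcfin : c ≠ ∞ := by simp [hc, ENNReal.rpow_eq_top_iff, hω0, hω1]
  have hDfin : ((2 * c) ^ m) ^ (1 / p) ≠ ∞ := by finiteness
  refine ⟨(((2 * c) ^ m) ^ (1 / p)).toNNReal, fun u hu hfin => ?_⟩
  rw [ENNReal.coe_toNNReal hDfin]
  set A : ℝ≥0∞ := (∫⁻ x, ‖u x‖ₑ ^ m) ^ (1 / m) with hA
  have hAfin : A ≠ ∞ := by finiteness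
  have hAm : A ^ m = ∫⁻ x, ‖u x‖ₑ ^ m := by
    rw [hA, ← ENNReal.rpow_mul, one_div_mul_cancel hm0.ne', ENNReal.rpow_one]
  clear_value A
  rcases eq_or_ne A 0 with h0 | hA0
  · rw [h0]; exact zero_le
  have hb : 0 < (n : ℝ) / m := by positivity
  have hab : s + (n : ℝ) / m = n / p := by rw [hnm]; field_simp; ring
  have pt : ∀ x, ‖u x‖ₑ ≤ 2 * c *
      (A ^ (s / (s + n / m)) * (energyAt s p u x ^ (1 / p)) ^ (n / m / (s + n / m))) := by
    intro x
    refine le_of_forall_radius hcfin hAfin hA0 hs hb fun R hR => ?_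
    obtain ⟨h0, h1⟩ := volume_ball_pos_ne_top x hR
    calc ‖u x‖ₑ = (volume (Metric.ball x R))⁻¹ * ∫⁻ _ in Metric.ball x R, ‖u x‖ₑ := by
          rw [setLIntegral_const, mul_comm, mul_assoc, ENNReal.mul_inv_cancel h0 h1, mul_one]
      _ ≤ (volume (Metric.ball x R))⁻¹ *
          ∫⁻ y in Metric.ball x R, (‖u x - u y‖ₑ + ‖u y‖ₑ) := by
          gcongr with y
          simpa using enorm_add_le (u x - u y) (u y)
      _ = (volume (Metric.ball x R))⁻¹ * (∫⁻ y in Metric.ball x R, ‖u x - u y‖ₑ) +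
          (volume (Metric.ball x R))⁻¹ * ∫⁻ y in Metric.ball x R, ‖u y‖ₑ := by
          rw [lintegral_add_right' _ hu.enorm.restrict, mul_add]
      _ ≤ ω ^ (-(1 / p)) * ENNReal.ofReal R ^ s * energyAt s p u x ^ (1 / p) +
          ω ^ (-(1 / m)) * ENNReal.ofReal R ^ (-(n / m)) * A :=
          add_le_add (mean_enorm_sub_le hn hs hp hu x hR)
            ((mean_enorm_ball_le hn (hp.trans hpm.le) hu x hR).trans_eq (by rw [hA]))
      _ ≤ c * ENNReal.ofReal R ^ s * energyAt s p u x ^ (1 / p) +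
          c * ENNReal.ofReal R ^ (-(n / m)) * A := by
          gcongr
          · exact le_max_left _ _
          · exact le_max_right _ _
      _ = _ := by ring
  have hσ : s / (s + n / m) * m = m - p := by
    rw [hab]
    have : s + (n : ℝ) / m = n / p := hab
    field_simp at this ⊢
    linarith
  have hτ : n / m / (s + n / m) * m = p := by
    rw [hab]; field_simp
  have pt' : ∀ x, ‖u x‖ₑ ^ m ≤ (2 * c) ^ m * A ^ (m - p) * energyAt s p u x := by
    intro x
    refine (ENNReal.rpow_le_rpow (pt x) hm0.le).trans (le_of_eq ?_)
    rw [ENNReal.mul_rpow_of_nonneg (2 * c) _ hm0.le,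
      ENNReal.mul_rpow_of_nonneg (A ^ _) _ hm0.le,
      ← ENNReal.rpow_mul A, hσ, ← ENNReal.rpow_mul _ _ m, hτ, ← ENNReal.rpow_mul (energyAt s p u x),
      one_div_mul_cancel hp0.ne', ENNReal.rpow_one, mul_assoc]
  have hint : A ^ m ≤ (2 * c) ^ m * A ^ (m - p) * gagliardo s p u ^ p := by
    rw [hAm, ← lintegral_energyAt s hp0 hu, ← lintegral_const_mul' _ _ (by
      have : 0 ≤ m - p := by linarith
      finiteness)]
    exact lintegral_mono pt'
  have hAp : A ^ p ≤ (2 * c) ^ m * gagliardo s p u ^ p := by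
    have e0 : A ^ (m - p) ≠ 0 := by simp [ENNReal.rpow_eq_zero_iff, hA0, hAfin]
    have e1 : A ^ (m - p) ≠ ∞ := ENNReal.rpow_ne_top_of_nonneg (by linarith) hAfin
    rw [← ENNReal.mul_le_mul_iff_right e0 e1, ← ENNReal.rpow_add _ _ hA0 hAfin, sub_add_cancel]
    exact hint.trans_eq (by ring)
  have := ENNReal.rpow_le_rpow hAp (one_div_nonneg.2 hp0.le)
  rwa [ENNReal.mul_rpow_of_nonneg _ _ (by positivity), ← ENNReal.rpow_mul A,
    ← ENNReal.rpow_mul (gagliardo s p u), mul_one_div_cancel hp0.ne', ENNReal.rpow_one,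
    ENNReal.rpow_one] at this

/-! ### The fractional Sobolev inequality by approximation -/

/-- Fatou's lemma for sequences converging almost everywhere with converging bounds. -/
theorem lintegral_le_of_ae_tendsto {α : Type*} [MeasurableSpace α] {μ : Measure α}
    {F : ℕ → α → ℝ≥0∞} {G : α → ℝ≥0∞} (hF : ∀ k, AEMeasurable (F k) μ)
    (h : ∀ᵐ x ∂μ, Tendsto (fun k => F k x) atTop (𝓝 (G x))) {b : ℕ → ℝ≥0∞} {B : ℝ≥0∞}
    (hb : ∀ k, ∫⁻ x, F k x ∂μ ≤ b k) (hB : Tendsto b atTop (𝓝 B)) : ∫⁻ x, G x ∂μ ≤ B := by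
  calc ∫⁻ x, G x ∂μ = ∫⁻ x, liminf (fun k => F k x) atTop ∂μ :=
        lintegral_congr_ae (h.mono fun x hx => hx.liminf_eq.symm)
    _ ≤ liminf (fun k => ∫⁻ x, F k x ∂μ) atTop := lintegral_liminf_le' hF
    _ ≤ liminf b atTop := liminf_le_liminf (Eventually.of_forall hb)
    _ = B := hB.liminf_eq

theorem tendsto_enorm_rpow {α : Type*} {l : Filter α} {m : ℝ} {f : α → ℝ} {a : ℝ}
    (h : Tendsto f l (𝓝 a)) : Tendsto (fun k => ‖f k‖ₑ ^ m) l (𝓝 (‖a‖ₑ ^ m)) :=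
  ENNReal.continuous_rpow_const.continuousAt.tendsto.comp h.enorm

/-- If `u` is an almost everywhere limit of functions in `L^{p*}` whose Gagliardo seminorms are
asymptotically at most `[u]`, the Sobolev inequality passes to `u`. -/
theorem sobolev_of_ae_tendsto {n : ℕ} {s p m : ℝ} (hm : 0 < m) {C : ℝ≥0}
    {φ : ℕ → E n → ℝ} {u : E n → ℝ} (hφ : ∀ k, AEMeasurable (φ k))
    (hφu : ∀ᵐ x, Tendsto (fun k => φ k x) atTop (𝓝 (u x))) {b : ℕ → ℝ≥0∞}
    (hC : ∀ k, (∫⁻ x, ‖φ k x‖ₑ ^ m) ^ (1 / m) ≤ C * b k)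
    (hb : Tendsto b atTop (𝓝 (gagliardo s p u))) :
    (∫⁻ x, ‖u x‖ₑ ^ m) ^ (1 / m) ≤ C * gagliardo s p u := by
  rw [rpow_one_div_le_iff (by positivity)]
  refine lintegral_le_of_ae_tendsto (fun k => (hφ k).enorm.pow_const m)
    (hφu.mono fun x hx => tendsto_enorm_rpow hx) (b := fun k => (C * b k) ^ m) (fun k => ?_)
    (ENNReal.continuous_rpow_const.continuousAt.tendsto.comp
      (ENNReal.Tendsto.const_mul hb (Or.inr ENNReal.coe_ne_top)))
  have := hC k
  rwa [rpow_one_div_le_iff (by positivity)] at this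

theorem gagliardo_mono {n : ℕ} {s p : ℝ} (hp : 0 ≤ p) {u w : E n → ℝ}
    (h : ∀ x y, |w x - w y| ≤ |u x - u y|) : gagliardo s p w ≤ gagliardo s p u := by
  unfold gagliardo
  gcongr ?_ ^ _
  refine lintegral_mono fun z => ?_
  gcongr
  exact enorm_le_iff_norm_le.2 (h z.1 z.2)

/-- The truncation `min (max (|t| - c) 0) d`. -/
noncomputable def trunc (c d t : ℝ) : ℝ := min (max (|t| - c) 0) d

theorem abs_trunc_sub_trunc_le (c d t t' : ℝ) : |trunc c d t - trunc c d t'| ≤ |t - t'| := by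
  unfold trunc
  refine (abs_min_sub_min_le_max _ _ _ _).trans (max_le ?_ (by simp))
  refine (abs_max_sub_max_le_max _ _ _ _).trans (max_le ?_ (by simp))
  rw [sub_sub_sub_cancel_right]
  exact abs_abs_sub_abs_le _ _

theorem continuous_trunc (c d : ℝ) : Continuous (trunc c d) := by
  unfold trunc; fun_prop

theorem tendsto_trunc (t : ℝ) :
    Tendsto (fun k : ℕ => trunc (1 / ((k : ℝ) + 1)) k t) atTop (𝓝 |t|) := by
  have h1 : Tendsto (fun k : ℕ => max (|t| - 1 / ((k : ℝ) + 1)) 0) atTop (𝓝 |t|) := by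
    have := (tendsto_one_div_add_atTop_nhds_zero_nat (𝕜 := ℝ)).const_sub |t|
    simpa using this.max (tendsto_const_nhds (x := (0 : ℝ)))
  refine h1.congr' ?_
  filter_upwards [tendsto_natCast_atTop_atTop.eventually_ge_atTop |t|] with k hk
  rw [trunc, min_eq_left]
  refine max_le ?_ (by positivity)
  have : (0 : ℝ) < 1 / ((k : ℝ) + 1) := by positivity
  linarith

/-- The truncation of a function vanishing at infinity is bounded with support of finite measure,
hence lies in every `L^m`. -/
theorem lintegral_trunc_ne_top {n : ℕ} {u : E n → ℝ} (hu : VanishesAtInfinity u) {m : ℝ}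
    (hm : 0 < m) {c d : ℝ} (hc : 0 < c) (hd : 0 ≤ d) :
    ∫⁻ x, ‖trunc c d (u x)‖ₑ ^ m ≠ ∞ := by
  set S := {x | c ≤ |u x|}
  have hb : ∀ x, ‖trunc c d (u x)‖ₑ ^ m ≤
      (toMeasurable volume S).indicator (fun _ => ENNReal.ofReal d ^ m) x := by
    intro x
    by_cases hx : x ∈ S
    · rw [Set.indicator_of_mem (subset_toMeasurable _ _ hx)]
      gcongr
      rw [← ofReal_norm, Real.norm_eq_abs]
      refine ENNReal.ofReal_le_ofReal ?_
      unfold trunc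
      rw [abs_of_nonneg (le_min (le_max_right _ _) hd)]
      exact min_le_right _ _
    · have : |u x| < c := not_le.1 hx
      have h0 : trunc c d (u x) = 0 := by
        rw [trunc, max_eq_right (by linarith), min_eq_left hd]
      simp [h0, hm]
  refine ((lintegral_mono hb).trans_lt ?_).ne
  rw [lintegral_indicator (measurableSet_toMeasurable _ _), setLIntegral_const,
    measure_toMeasurable]
  exact ENNReal.mul_lt_top (by finiteness) (hu c hc)

/-- The fractional Sobolev inequality for functions vanishing at infinity. -/
theorem exists_sobolev {n : ℕ} (hn : 0 < n) {s p : ℝ} (hs : 0 < s) (hp : 1 ≤ p)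
    (hsp : s * p < n) :
    ∃ C : ℝ≥0, ∀ u : E n → ℝ, AEMeasurable u → VanishesAtInfinity u →
      (∫⁻ x, ‖u x‖ₑ ^ pstar n s p) ^ (1 / pstar n s p) ≤ C * gagliardo s p u := by
  have hm : 0 < pstar n s p := by linarith [lt_pstar hs (by linarith) hsp]
  obtain ⟨C, hC⟩ := exists_sobolev_of_ne_top hn hs hp hsp
  refine ⟨C, fun u hu hv => ?_⟩
  have hmeas : ∀ k : ℕ, AEMeasurable fun x => trunc (1 / ((k : ℝ) + 1)) k (u x) := fun k =>
    (continuous_trunc _ _).measurable.comp_aemeasurable hu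
  rw [rpow_one_div_le_iff (by positivity)]
  refine lintegral_le_of_ae_tendsto (b := fun _ => (C * gagliardo s p u) ^ pstar n s p)
    (fun k => (hmeas k).enorm.pow_const (pstar n s p))
    (Eventually.of_forall fun x => ?_) (fun k => ?_) tendsto_const_nhds
  · simpa using tendsto_enorm_rpow (m := pstar n s p) (tendsto_trunc (u x))
  · have := (hC _ (hmeas k) (lintegral_trunc_ne_top hv hm (by positivity) (by positivity))).trans
      (mul_le_mul_right (gagliardo_mono (by linarith) (u := u)
        fun x y => abs_trunc_sub_trunc_le _ _ _ _) _)
    rwa [rpow_one_div_le_iff (by positivity)] at this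

theorem gagliardo_le_add {n : ℕ} (s : ℝ) {p : ℝ} (hp : 1 ≤ p) {u w : E n → ℝ}
    (hu : AEMeasurable u) (hw : AEMeasurable w) :
    gagliardo s p w ≤ gagliardo s p (fun x => w x - u x) + gagliardo s p u := by
  have hp0 : 0 < p := by linarith
  set D : E n × E n → ℝ≥0∞ := fun z => ‖z.1 - z.2‖ₑ ^ (((n : ℝ) + s * p) / p) with hD
  have hDm : Measurable D := by fun_prop
  have hk : ∀ f : E n → ℝ, gagliardo s p f =
      (∫⁻ z : E n × E n, (‖f z.1 - f z.2‖ₑ / D z) ^ p) ^ (1 / p) := by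
    intro f
    simp only [gagliardo, hD]
    congr 2 with z
    rw [ENNReal.div_rpow_of_nonneg _ _ hp0.le, ← ENNReal.rpow_mul, div_mul_cancel₀ _ hp0.ne']
  have hm : ∀ f : E n → ℝ, AEMeasurable f →
      AEMeasurable (fun z : E n × E n => ‖f z.1 - f z.2‖ₑ / D z) := by
    intro f hf
    have h1 : AEMeasurable (fun z : E n × E n => f z.1) ((volume : Measure (E n)).prod volume) :=
      hf.comp_quasiMeasurePreserving Measure.quasiMeasurePreserving_fst
    have h2 : AEMeasurable (fun z : E n × E n => f z.2) ((volume : Measure (E n)).prod volume) :=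
      hf.comp_quasiMeasurePreserving Measure.quasiMeasurePreserving_snd
    exact (h1.sub h2).enorm.div hDm.aemeasurable
  rw [hk, hk, hk]
  refine le_trans ?_ (ENNReal.lintegral_Lp_add_le (hm _ (hw.sub hu)) (hm _ hu) hp)
  gcongr ?_ ^ _
  refine lintegral_mono fun z => ?_
  simp only [Pi.add_apply]
  gcongr
  rw [← ENNReal.add_div]
  gcongr
  refine le_trans (le_of_eq ?_) (enorm_add_le _ _)
  congr 1; ring

theorem wnorm_eq_eLpNorm {n : ℕ} {q : ℝ} (hq : 0 < q) {V : E n → ℝ} (hV : AEMeasurable V)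
    {u : E n → ℝ} (hu : AEMeasurable u) :
    wnorm q V u = eLpNorm u (ENNReal.ofReal q)
      (volume.withDensity fun x => ENNReal.ofReal (V x)) := by
  rw [eLpNorm_eq_lintegral_rpow_enorm_toReal (by simpa using hq) ENNReal.ofReal_ne_top,
    ENNReal.toReal_ofReal hq.le, lintegral_withDensity_eq_lintegral_mul₀ hV.ennreal_ofReal
      (hu.enorm.pow_const q), wnorm]
  simp only [Pi.mul_apply, mul_comm]

/-- The fractional Sobolev inequality on `M_V^{s;q,p}(ℝⁿ)`. -/
theorem exists_sobolev_spaceMV {n : ℕ} (hn : 0 < n) {s p q : ℝ} (hs : 0 < s) (hp : 1 ≤ p)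
    (hsp : s * p < n) (hq : 0 < q) :
    ∃ C : ℝ≥0, ∀ V : E n → ℝ, AEMeasurable V → (∀ x, 0 < V x) → ∀ u ∈ spaceMV s q p V,
      (∫⁻ x, ‖u x‖ₑ ^ pstar n s p) ^ (1 / pstar n s p) ≤ C * gagliardo s p u := by
  have hm : 0 < pstar n s p := by linarith [lt_pstar hs (by linarith) hsp]
  obtain ⟨C, hC⟩ := exists_sobolev_of_ne_top hn hs hp hsp
  refine ⟨C, ?_⟩
  rintro V hV hV0 u ⟨hu, -, φ, hφ, hlim⟩
  have hφm : ∀ k, AEMeasurable (φ k) := fun k => (hφ k).1.continuous.aemeasurable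
  set μ := (volume : Measure (E n)).withDensity fun x => ENNReal.ofReal (V x) with hμ
  have hac : μ ≪ volume := withDensity_absolutelyContinuous _ _
  have hac' : volume ≪ μ :=
    withDensity_absolutelyContinuous' hV.ennreal_ofReal (Eventually.of_forall fun x => by
      simpa using hV0 x)
  have h1 : Tendsto (fun k => eLpNorm (φ k - u) (ENNReal.ofReal q) μ) atTop (𝓝 0) := by
    refine tendsto_of_tendsto_of_tendsto_of_le_of_le tendsto_const_nhds hlim
      (fun _ => zero_le) fun k => ?_
    rw [← wnorm_eq_eLpNorm hq hV ((hφm k).sub hu)]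
    exact le_self_add
  have h2 : Tendsto (fun k => gagliardo s p (fun x => φ k x - u x)) atTop (𝓝 0) :=
    tendsto_of_tendsto_of_tendsto_of_le_of_le tendsto_const_nhds hlim
      (fun _ => zero_le) fun k => le_add_self
  obtain ⟨θ, hθ, hae⟩ := (tendstoInMeasure_of_tendsto_eLpNorm (by simpa using hq)
    (fun k => ((hφm k).mono_ac hac).aestronglyMeasurable)
    (hu.mono_ac hac).aestronglyMeasurable h1).exists_seq_tendsto_ae
  refine sobolev_of_ae_tendsto hm (C := C) (fun k => hφm (θ k)) (hac'.ae_le hae)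
    (b := fun k => gagliardo s p (fun x => φ (θ k) x - u x) + gagliardo s p u) (fun k => ?_) ?_
  · refine (hC _ (hφm (θ k)) ?_).trans (mul_le_mul_right (gagliardo_le_add s hp hu (hφm _)) _)
    have := ((hφ (θ k)).1.continuous.memLp_of_hasCompactSupport (μ := volume)
      (p := ENNReal.ofReal (pstar n s p)) (hφ (θ k)).2).eLpNorm_lt_top
    rw [eLpNorm_lt_top_iff_lintegral_rpow_enorm_lt_top (by simpa using hm) ENNReal.ofReal_ne_top,
      ENNReal.toReal_ofReal hm.le] at this
    exact this.ne
  · simpa using (h2.comp hθ.tendsto_atTop).add_const (gagliardo s p u)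

/-! ### Weak compactness and approximation by ball means -/

/-- A sequence bounded in `L^m`, `1 < m < ∞`, has a subsequence whose integrals over each set of
finite measure converge. This is the sequential Banach-Alaoglu theorem in the dual of the separable
space `L^{m'}`, tested against indicator functions. -/
theorem exists_subseq_tendsto_setIntegral {α : Type*} [MeasurableSpace α]
    [MeasurableSpace.CountablyGenerated α] {μ : Measure α} [SigmaFinite μ] {m : ℝ} (hm : 1 < m)
    {u : ℕ → α → ℝ} (hu : ∀ k, AEMeasurable (u k) μ) {B : ℝ≥0}
    (hB : ∀ k, (∫⁻ x, ‖u k x‖ₑ ^ m ∂μ) ^ (1 / m) ≤ B) :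
    ∃ θ : ℕ → ℕ, StrictMono θ ∧ ∀ S, MeasurableSet S → μ S ≠ ∞ →
      ∃ L : ℝ, Tendsto (fun k => ∫ y in S, u (θ k) y ∂μ) atTop (𝓝 L) := by
  have hm0 : 0 < m := by linarith
  have hconj : m.HolderConjugate m.conjExponent := Real.HolderConjugate.conjExponent hm
  set P := ENNReal.ofReal m with hP
  set Q := ENNReal.ofReal m.conjExponent with hQ
  have : ENNReal.HolderConjugate P Q := hconj.ennrealOfReal
  have : Fact (1 ≤ P) := ⟨by simpa [hP] using hm.le⟩
  have : Fact (1 ≤ Q) := ⟨by simpa [hQ] using hconj.symm.lt.le⟩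
  have : Fact (Q ≠ ∞) := ⟨ENNReal.ofReal_ne_top⟩
  have hnorm : ∀ k, eLpNorm (u k) P μ ≤ B := fun k => by
    rw [eLpNorm_eq_lintegral_rpow_enorm_toReal (by simpa [hP] using hm0) ENNReal.ofReal_ne_top,
      ENNReal.toReal_ofReal hm0.le]
    exact hB k
  have hmem : ∀ k, MemLp (u k) P μ := fun k =>
    ⟨(hu k).aestronglyMeasurable, (hnorm k).trans_lt ENNReal.coe_lt_top⟩
  let T : Lp ℝ P μ →L[ℝ] Lp ℝ Q μ →L[ℝ] ℝ := (ContinuousLinearMap.mul ℝ ℝ).lpPairing μ P Q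
  let ℓ : ℕ → WeakDual ℝ (Lp ℝ Q μ) := fun k => StrongDual.toWeakDual (T ((hmem k).toLp))
  have hℓ : ∀ k, ℓ k ∈ WeakDual.toStrongDual ⁻¹'
      Metric.closedBall (0 : StrongDual ℝ (Lp ℝ Q μ)) (‖T‖ * B) := by
    intro k
    rw [Set.mem_preimage, mem_closedBall_zero_iff]
    refine (T.le_opNorm _).trans ?_
    gcongr
    rw [Lp.norm_toLp]
    exact ENNReal.toReal_le_coe_of_le_coe (hnorm k)
  obtain ⟨ℓ', -, θ, hθ, hlim⟩ := WeakDual.isSeqCompact_closedBall ℝ (Lp ℝ Q μ) _ _ hℓ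
  refine ⟨θ, hθ, fun S hS hμS => ⟨ℓ' (indicatorConstLp Q hS hμS (1 : ℝ)), ?_⟩⟩
  have h := ((WeakDual.eval_continuous (indicatorConstLp Q hS hμS (1 : ℝ))).tendsto ℓ').comp hlim
  refine h.congr fun k => ?_
  change T ((hmem (θ k)).toLp) (indicatorConstLp Q hS hμS (1 : ℝ)) = _
  rw [ContinuousLinearMap.lpPairing_eq_integral, ← integral_indicator hS]
  refine integral_congr_ae ?_
  filter_upwards [(hmem (θ k)).coeFn_toLp,
    indicatorConstLp_coeFn (p := Q) (hs := hS) (hμs := hμS) (c := (1 : ℝ))] with x h1 h2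
  rw [h1, h2]
  by_cases hx : x ∈ S <;> simp [hx]

/-- The mean of `u` over the ball of radius `R` centred at `x`. -/
noncomputable def ballMean {n : ℕ} (R : ℝ) (u : E n → ℝ) (x : E n) : ℝ :=
  (volume (Metric.ball x R)).toReal⁻¹ * ∫ y in Metric.ball x R, u y

theorem enorm_inv_volume_ball {n : ℕ} (x : E n) {R : ℝ} (hR : 0 < R) :
    ‖(volume (Metric.ball x R)).toReal⁻¹‖ₑ = (volume (Metric.ball x R))⁻¹ := by
  obtain ⟨h0, h1⟩ := volume_ball_pos_ne_top x hR
  rw [enorm_inv (by simp [ENNReal.toReal_eq_zero_iff, h0, h1]),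
    Real.enorm_eq_ofReal (by positivity),
    ENNReal.ofReal_toReal h1]

theorem enorm_ballMean_le {n : ℕ} (u : E n → ℝ) (x : E n) {R : ℝ} (hR : 0 < R) :
    ‖ballMean R u x‖ₑ ≤ (volume (Metric.ball x R))⁻¹ * ∫⁻ y in Metric.ball x R, ‖u y‖ₑ := by
  rw [ballMean, enorm_mul, enorm_inv_volume_ball x hR]
  gcongr
  exact enorm_integral_le_lintegral_enorm _

theorem enorm_sub_ballMean_le {n : ℕ} {u : E n → ℝ} (hu : LocallyIntegrable u) (x : E n) {R : ℝ}
    (hR : 0 < R) : ‖u x - ballMean R u x‖ₑ ≤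
      (volume (Metric.ball x R))⁻¹ * ∫⁻ y in Metric.ball x R, ‖u x - u y‖ₑ := by
  obtain ⟨h0, h1⟩ := volume_ball_pos_ne_top x hR
  have hi : IntegrableOn u (Metric.ball x R) :=
    (hu.integrableOn_isCompact (isCompact_closedBall x R)).mono_set Metric.ball_subset_closedBall
  have hc : IntegrableOn (fun _ => u x) (Metric.ball x R) := integrableOn_const h1
  have : u x - ballMean R u x =
      (volume (Metric.ball x R)).toReal⁻¹ * ∫ y in Metric.ball x R, (u x - u y) := by
    rw [integral_sub hc hi, setIntegral_const, ballMean, mul_sub, smul_eq_mul,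
      Measure.real, inv_mul_cancel_left₀ (by simp [ENNReal.toReal_eq_zero_iff, h0, h1])]
  rw [this, enorm_mul, enorm_inv_volume_ball x hR]
  gcongr
  exact enorm_integral_le_lintegral_enorm _

theorem aestronglyMeasurable_ballMean {n : ℕ} {u : E n → ℝ} (hu : AEMeasurable u)
    (R : ℝ) : AEStronglyMeasurable (ballMean R u) := by
  have hball : ∀ x : E n, volume (Metric.ball x R) = volume (Metric.ball (0 : E n) R) := fun x =>
    Measure.addHaar_ball_center _ _ _
  have hS : MeasurableSet {z : E n × E n | dist z.2 z.1 < R} :=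
    measurableSet_lt (by fun_prop) measurable_const
  have h2 : AEStronglyMeasurable (fun z : E n × E n => u z.2)
      ((volume : Measure (E n)).prod volume) :=
    (hu.comp_quasiMeasurePreserving Measure.quasiMeasurePreserving_snd).aestronglyMeasurable
  refine ((h2.indicator hS).integral_prod_right'.const_mul
    (volume (Metric.ball (0 : E n) R)).toReal⁻¹).congr (Eventually.of_forall fun x => ?_)
  simp only [ballMean, hball]
  congr 1
  rw [← integral_indicator measurableSet_ball]
  rfl

/-- In `L^p`, a function differs from its means over balls of radius `R` by at most a multiple of
`R ^ s` times its Gagliardo seminorm. -/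
theorem eLpNorm_sub_ballMean_le {n : ℕ} (hn : 0 < n) {s p : ℝ} (hs : 0 < s) (hp : 1 ≤ p)
    {u : E n → ℝ} (hu : AEMeasurable u) (hloc : LocallyIntegrable u) {R : ℝ} (hR : 0 < R) :
    eLpNorm (u - ballMean R u) (ENNReal.ofReal p) volume ≤
      volume (Metric.ball (0 : E n) 1) ^ (-(1 / p)) * ENNReal.ofReal R ^ s *
        gagliardo s p u := by
  have hp0 : 0 < p := by linarith
  obtain ⟨h0, h1⟩ := volume_ball_pos_ne_top (0 : E n) one_pos
  rw [eLpNorm_eq_lintegral_rpow_enorm_toReal (by simpa using hp0) ENNReal.ofReal_ne_top,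
    ENNReal.toReal_ofReal hp0.le, rpow_one_div_le_iff hp0]
  set c := volume (Metric.ball (0 : E n) 1) ^ (-(1 / p)) * ENNReal.ofReal R ^ s with hc
  have hcfin : c ≠ ∞ := ENNReal.mul_ne_top (by simp [ENNReal.rpow_eq_top_iff, h0, h1])
    (by finiteness)
  rw [ENNReal.mul_rpow_of_nonneg _ _ hp0.le, ← lintegral_energyAt s hp0 hu,
    ← lintegral_const_mul' _ _ (by finiteness)]
  refine lintegral_mono fun x => ?_
  have := (enorm_sub_ballMean_le hloc x hR).trans (mean_enorm_sub_le hn hs hp hu x hR)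
  refine (ENNReal.rpow_le_rpow this hp0.le).trans (le_of_eq ?_)
  rw [ENNReal.mul_rpow_of_nonneg _ _ hp0.le, ← ENNReal.rpow_mul _ _ p,
    one_div_mul_cancel hp0.ne', ENNReal.rpow_one]

/-! ### Almost everywhere convergence of a subsequence -/

/-- There is a finite measure with the same null sets as a given `σ`-finite one, and below it. -/
theorem exists_isFiniteMeasure_le {α : Type*} [MeasurableSpace α] (μ : Measure α)
    [SigmaFinite μ] : ∃ ν : Measure α, IsFiniteMeasure ν ∧ ν ≤ μ ∧ μ ≪ ν := by
  obtain ⟨g, hg0, hg, hint⟩ := exists_pos_lintegral_lt_of_sigmaFinite μ one_ne_zero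
  have hm : Measurable fun x => ((min (g x) 1 : ℝ≥0) : ℝ≥0∞) :=
    (hg.min measurable_const).coe_nnreal_ennreal
  refine ⟨μ.withDensity fun x => ((min (g x) 1 : ℝ≥0) : ℝ≥0∞), ?_, ?_, ?_⟩
  · refine isFiniteMeasure_withDensity (ne_top_of_le_ne_top hint.ne_top ?_)
    exact lintegral_mono fun x => by gcongr; exact min_le_left _ _
  · calc μ.withDensity (fun x => ((min (g x) 1 : ℝ≥0) : ℝ≥0∞)) ≤ μ.withDensity 1 :=
          withDensity_mono (Eventually.of_forall fun x => by simp)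
      _ = μ := withDensity_one
  · refine withDensity_absolutelyContinuous' hm.aemeasurable (Eventually.of_forall fun x => ?_)
    simpa using (hg0 x).ne'

/-- Rellich-Kondrachov in its weakest form: a sequence bounded in `L^m` and in the Gagliardo
seminorm has a subsequence that converges almost everywhere. -/
theorem exists_subseq_ae_tendsto {n : ℕ} (hn : 0 < n) {s p m : ℝ} (hs : 0 < s) (hp : 1 ≤ p)
    (hpm : p < m) {u : ℕ → E n → ℝ} (hu : ∀ k, AEMeasurable (u k)) {B M : ℝ≥0}
    (hB : ∀ k, (∫⁻ x, ‖u k x‖ₑ ^ m) ^ (1 / m) ≤ B) (hM : ∀ k, gagliardo s p (u k) ≤ M) :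
    ∃ θ : ℕ → ℕ, StrictMono θ ∧ ∃ v : E n → ℝ, AEMeasurable v ∧
      ∀ᵐ x, Tendsto (fun k => u (θ k) x) atTop (𝓝 (v x)) := by
  have hp0 : 0 < p := by linarith
  have hm0 : 0 < m := by linarith
  obtain ⟨θ, hθ, hlim⟩ := exists_subseq_tendsto_setIntegral (by linarith : 1 < m) hu hB
  obtain ⟨μ, hμfin, hμle, hac⟩ := exists_isFiniteMeasure_le (volume : Measure (E n))
  have hμac : μ ≪ volume := hμle.absolutelyContinuous
  set w : ℕ → E n → ℝ := fun k => u (θ k) with hw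
  set P := ENNReal.ofReal p with hP
  have hP1 : 1 ≤ P := by simpa [hP] using hp
  have : Fact (1 ≤ P) := ⟨hP1⟩
  have hmemv : ∀ k, MemLp (w k) (ENNReal.ofReal m) volume := fun k => by
    refine ⟨(hu _).aestronglyMeasurable, ?_⟩
    rw [eLpNorm_eq_lintegral_rpow_enorm_toReal (by simpa using hm0) ENNReal.ofReal_ne_top,
      ENNReal.toReal_ofReal hm0.le]
    exact (hB _).trans_lt ENNReal.coe_lt_top
  have hloc : ∀ k, LocallyIntegrable (w k) := fun k =>
    (hmemv k).locallyIntegrable (by simpa using (hp.trans hpm.le))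
  have hmem : ∀ k, MemLp (w k) P μ := fun k =>
    ((hmemv k).mono_measure hμle).mono_exponent (ENNReal.ofReal_le_ofReal hpm.le)
  have hwm : ∀ k, AEStronglyMeasurable (w k) μ := fun k => (hmem k).1
  have hbm : ∀ R k, AEStronglyMeasurable (ballMean R (w k)) μ := fun R k =>
    (aestronglyMeasurable_ballMean (hu _) R).mono_ac hμac
  obtain ⟨h0, h1⟩ := volume_ball_pos_ne_top (0 : E n) one_pos
  set ω := volume (Metric.ball (0 : E n) 1)
  have hωfin : ∀ a : ℝ, ω ^ a ≠ ∞ := fun a => by simp [ENNReal.rpow_eq_top_iff, h0, h1]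
  -- for a fixed radius the ball means converge boundedly, hence they are Cauchy in `L^p(μ)`
  have hmean : ∀ R, 0 < R → Tendsto (fun i : ℕ × ℕ =>
      eLpNorm (ballMean R (w i.1) - ballMean R (w i.2)) P μ) atTop (𝓝 0) := by
    intro R hR
    have hbd : ∀ k x, ‖ballMean R (w k) x‖ₑ ≤
        ω ^ (-(1 / m)) * ENNReal.ofReal R ^ (-(n / m)) * B := fun k x =>
      ((enorm_ballMean_le _ x hR).trans (mean_enorm_ball_le hn (hp.trans hpm.le) (hu _) x hR)).trans
        (by gcongr; exact hB _)
    set D : ℝ≥0∞ := ω ^ (-(1 / m)) * ENNReal.ofReal R ^ (-(n / m)) * B with hD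
    have hDfin : D ≠ ∞ := ENNReal.mul_ne_top (ENNReal.mul_ne_top (hωfin _)
      (by simp [ENNReal.rpow_eq_top_iff, hR])) ENNReal.coe_ne_top
    have hconv : Tendsto (fun i : ℕ × ℕ =>
        ∫⁻ x, ‖ballMean R (w i.1) x - ballMean R (w i.2) x‖ₑ ^ p ∂μ) atTop
        (𝓝 (∫⁻ _, 0 ∂μ)) := by
      refine tendsto_lintegral_filter_of_dominated_convergence' (fun _ => (D + D) ^ p)
        (Eventually.of_forall fun i => ((hbm R i.1).sub (hbm R i.2)).enorm.pow_const p)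
        (Eventually.of_forall fun i => Eventually.of_forall fun x => ?_) ?_
        (Eventually.of_forall fun x => ?_)
      · gcongr
        exact (enorm_sub_le).trans (add_le_add (hbd _ x) (hbd _ x))
      · rw [lintegral_const]
        finiteness
      · obtain ⟨L, hL⟩ := hlim (Metric.ball x R) measurableSet_ball (volume_ball_pos_ne_top x hR).2
        have hL' : Tendsto (fun k => ballMean R (w k) x) atTop
            (𝓝 ((volume (Metric.ball x R)).toReal⁻¹ * L)) := hL.const_mul _
        rw [← prod_atTop_atTop_eq]
        have := tendsto_enorm_rpow (m := p)
          ((hL'.comp tendsto_fst).sub (hL'.comp (tendsto_snd (f := (atTop : Filter ℕ)))))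
        simpa [hp0] using this
    rw [lintegral_zero] at hconv
    have := (ENNReal.continuous_rpow_const (y := 1 / p)).tendsto 0 |>.comp hconv
    rw [ENNReal.zero_rpow_of_pos (by positivity)] at this
    refine this.congr fun i => ?_
    rw [eLpNorm_eq_lintegral_rpow_enorm_toReal (by simpa [hP] using hp0) ENNReal.ofReal_ne_top,
      ENNReal.toReal_ofReal hp0.le]
    rfl
  have hosc : ∀ R, 0 < R → ∀ k, eLpNorm (w k - ballMean R (w k)) P μ ≤
      ω ^ (-(1 / p)) * ENNReal.ofReal R ^ s * M := fun R hR k =>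
    (eLpNorm_mono_measure _ hμle).trans ((eLpNorm_sub_ballMean_le hn hs hp (hu _) (hloc k) hR).trans
      (by gcongr; exact hM _))
  have hcauchy : Tendsto (fun i : ℕ × ℕ => eLpNorm (w i.1 - w i.2) P μ) atTop (𝓝 0) := by
    rw [ENNReal.tendsto_nhds_zero]
    intro ε hε
    have hsmall : Tendsto (fun R : ℝ => ω ^ (-(1 / p)) * ENNReal.ofReal R ^ s * M)
        (𝓝[>] 0) (𝓝 (ω ^ (-(1 / p)) * ENNReal.ofReal 0 ^ s * M)) := by
      refine Tendsto.mono_left ?_ nhdsWithin_le_nhds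
      refine ENNReal.Tendsto.mul_const (ENNReal.Tendsto.const_mul ?_ (Or.inr (hωfin _)))
        (Or.inr ENNReal.coe_ne_top)
      exact (ENNReal.continuous_rpow_const.comp ENNReal.continuous_ofReal).tendsto 0
    rw [ENNReal.ofReal_zero, ENNReal.zero_rpow_of_pos hs, mul_zero, zero_mul,
      ENNReal.tendsto_nhds_zero] at hsmall
    have hε3 : 0 < ε / 3 := ENNReal.div_pos hε.ne' (by norm_num)
    obtain ⟨R, hRε, hR⟩ := ((hsmall _ hε3).and self_mem_nhdsWithin).exists
    filter_upwards [ENNReal.tendsto_nhds_zero.1 (hmean R hR) _ hε3] with i hi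
    calc eLpNorm (w i.1 - w i.2) P μ
        = eLpNorm ((w i.1 - ballMean R (w i.1)) + (ballMean R (w i.1) - ballMean R (w i.2)) -
            (w i.2 - ballMean R (w i.2))) P μ := by congr 1; abel
      _ ≤ eLpNorm (w i.1 - ballMean R (w i.1)) P μ +
            eLpNorm (ballMean R (w i.1) - ballMean R (w i.2)) P μ +
            eLpNorm (w i.2 - ballMean R (w i.2)) P μ := by
          refine (eLpNorm_sub_le (((hwm _).sub (hbm R _)).add ((hbm R _).sub (hbm R _)))
            ((hwm _).sub (hbm R _)) hP1).trans ?_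
          gcongr
          exact eLpNorm_add_le ((hwm _).sub (hbm R _)) ((hbm R _).sub (hbm R _)) hP1
      _ ≤ ε / 3 + ε / 3 + ε / 3 :=
          add_le_add (add_le_add ((hosc R hR _).trans hRε) hi) ((hosc R hR _).trans hRε)
      _ = ε := ENNReal.add_thirds ε
  have hcs : CauchySeq fun k => (hmem k).toLp := by
    rw [Lp.cauchySeq_Lp_iff_cauchySeq_eLpNorm]
    refine hcauchy.congr fun i => eLpNorm_congr_ae ?_
    exact ((hmem i.1).coeFn_toLp.sub (hmem i.2).coeFn_toLp).symm
  obtain ⟨v, hv⟩ := cauchySeq_tendsto_of_complete hcs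
  obtain ⟨η, hη, hae⟩ := (tendstoInMeasure_of_tendsto_Lp hv).exists_seq_tendsto_ae
  have hall : ∀ᵐ x ∂μ, ∀ k, (hmem k).toLp (w k) x = w k x :=
    ae_all_iff.2 fun k => (hmem k).coeFn_toLp
  refine ⟨θ ∘ η, hθ.comp hη, v, (Lp.aestronglyMeasurable v).aemeasurable.mono_ac hac, ?_⟩
  refine hac.ae_le ?_
  filter_upwards [hae, hall] with x h2 h3
  exact h2.congr fun k => h3 _

/-! ### Vitali convergence in the weighted space -/

theorem aemeasurable_enorm_rpow_mul {n : ℕ} {r : ℝ} {K u : E n → ℝ} (hK : AEMeasurable K)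
    (hu : AEMeasurable u) : AEMeasurable fun x => ‖u x‖ₑ ^ r * ENNReal.ofReal (K x) :=
  (hu.enorm.pow_const r).mul hK.ennreal_ofReal

/-- Vitali's convergence theorem in `L^r(K)`: if the integrals of `|u_k|^r K` over measurable sets
are controlled, uniformly in `k`, by a positive power of the integral of a fixed integrable function
`H > 0`, then almost everywhere convergence implies convergence in `L^r(K)`. -/
theorem tendsto_wnorm_of_ae_tendsto {n : ℕ} {r : ℝ} (hr : 1 ≤ r) {K H : E n → ℝ}
    (hK : AEMeasurable K) (hK0 : ∀ x, 0 < K x) (hH : Integrable H) (hH0 : ∀ x, 0 < H x)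
    {c : ℝ} (hc : 0 < c) {D : ℝ≥0} {u : ℕ → E n → ℝ} {v : E n → ℝ}
    (hu : ∀ k, AEMeasurable (u k)) (hv : AEMeasurable v)
    (huv : ∀ᵐ x, Tendsto (fun k => u k x) atTop (𝓝 (v x)))
    (hest : ∀ k A, MeasurableSet A → ∫⁻ x in A, ‖u k x‖ₑ ^ r * ENNReal.ofReal (K x) ≤
      D * (∫⁻ x in A, ENNReal.ofReal (H x)) ^ c) :
    wnorm r K v < ∞ ∧ Tendsto (fun k => wnorm r K (fun x => u k x - v x)) atTop (𝓝 0) := by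
  have hr0 : 0 < r := by linarith
  have hHm : AEMeasurable H := hH.aemeasurable
  have hHfin : ∫⁻ x, ENNReal.ofReal (H x) ≠ ∞ :=
    ((hasFiniteIntegral_iff_ofReal (Eventually.of_forall fun x => (hH0 x).le)).1 hH.2).ne
  have hestv : ∀ A, MeasurableSet A → ∫⁻ x in A, ‖v x‖ₑ ^ r * ENNReal.ofReal (K x) ≤
      D * (∫⁻ x in A, ENNReal.ofReal (H x)) ^ c := fun A hA =>
    lintegral_le_of_ae_tendsto (fun k => (aemeasurable_enorm_rpow_mul hK (hu k)).restrict)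
      (ae_restrict_of_ae (huv.mono fun x hx =>
        ENNReal.Tendsto.mul_const (tendsto_enorm_rpow (m := r) hx) (Or.inr ENNReal.ofReal_ne_top)))
      (fun k => hest k A hA) tendsto_const_nhds
  refine ⟨?_, ?_⟩
  · rw [wnorm, ENNReal.rpow_lt_top_iff_of_pos (by positivity)]
    refine lt_of_le_of_lt ?_
      (ENNReal.mul_lt_top (ENNReal.coe_lt_top (r := D)) (by finiteness :
        (∫⁻ x, ENNReal.ofReal (H x)) ^ c < ∞))
    simpa using hestv Set.univ MeasurableSet.univ
  set D' : ℝ≥0∞ := 2 ^ (r - 1) * (D + D) with hD'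
  have hD'fin : D' ≠ ∞ := ENNReal.mul_ne_top
    (ENNReal.rpow_ne_top_of_nonneg (by linarith) (by simp)) (by finiteness)
  have hsub : ∀ k, AEMeasurable fun x => u k x - v x := fun k => (hu k).sub hv
  have hestd : ∀ k A, MeasurableSet A →
      ∫⁻ x in A, ‖u k x - v x‖ₑ ^ r * ENNReal.ofReal (K x) ≤
      D' * (∫⁻ x in A, ENNReal.ofReal (H x)) ^ c := by
    intro k A hA
    calc ∫⁻ x in A, ‖u k x - v x‖ₑ ^ r * ENNReal.ofReal (K x)
        ≤ ∫⁻ x in A, 2 ^ (r - 1) * (‖u k x‖ₑ ^ r * ENNReal.ofReal (K x) +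
            ‖v x‖ₑ ^ r * ENNReal.ofReal (K x)) := by
          refine lintegral_mono fun x => ?_
          rw [← add_mul, ← mul_assoc]
          gcongr
          exact (ENNReal.rpow_le_rpow enorm_sub_le hr0.le).trans
            (ENNReal.rpow_add_le_mul_rpow_add_rpow _ _ hr)
      _ = 2 ^ (r - 1) * ((∫⁻ x in A, ‖u k x‖ₑ ^ r * ENNReal.ofReal (K x)) +
            ∫⁻ x in A, ‖v x‖ₑ ^ r * ENNReal.ofReal (K x)) := by
          rw [lintegral_const_mul' _ _ (ENNReal.rpow_ne_top_of_nonneg (by linarith) (by simp)),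
            lintegral_add_left' (aemeasurable_enorm_rpow_mul hK (hu k)).restrict]
      _ ≤ 2 ^ (r - 1) * (D * (∫⁻ x in A, ENNReal.ofReal (H x)) ^ c +
            D * (∫⁻ x in A, ENNReal.ofReal (H x)) ^ c) := by
          gcongr
          · exact hest k A hA
          · exact hestv A hA
      _ = _ := by rw [hD']; ring
  -- with respect to the finite measure `ν = H dx`, the densities `f k` are uniformly integrable
  set ν := (volume : Measure (E n)).withDensity fun x => ENNReal.ofReal (H x) with hν
  have : IsFiniteMeasure ν := isFiniteMeasure_withDensity hHfin
  have hac : ν ≪ volume := withDensity_absolutelyContinuous _ _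
  set f : ℕ → E n → ℝ := fun k x => |u k x - v x| ^ r * K x / H x with hf
  have hfm : ∀ k, AEMeasurable (f k) := fun k =>
    (((measurable_norm.comp_aemeasurable (hsub k)).pow_const r).mul hK).div hHm
  have hfe : ∀ k x, ENNReal.ofReal (H x) * ‖f k x‖ₑ =
      ‖u k x - v x‖ₑ ^ r * ENNReal.ofReal (K x) := by
    intro k x
    have hk := (hK0 x).le
    have hh := (hH0 x)
    rw [hf, Real.enorm_eq_ofReal (by positivity), ← ENNReal.ofReal_mul hh.le,
      mul_div_cancel₀ _ hh.ne', ENNReal.ofReal_mul (by positivity),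
      ← ENNReal.ofReal_rpow_of_nonneg (abs_nonneg _) hr0.le, Real.enorm_eq_ofReal_abs]
  have hfi : ∀ k A, MeasurableSet A → ∫⁻ x in A, ‖f k x‖ₑ ∂ν =
      ∫⁻ x in A, ‖u k x - v x‖ₑ ^ r * ENNReal.ofReal (K x) := by
    intro k A hA
    rw [hν, restrict_withDensity hA, lintegral_withDensity_eq_lintegral_mul₀
      hHm.ennreal_ofReal.restrict (hfm k).enorm.restrict]
    exact lintegral_congr fun x => hfe k x
  have hui : UnifIntegrable f 1 ν := by
    intro ε hε
    have hsmall : Tendsto (fun δ : ℝ => D' * ENNReal.ofReal δ ^ c) (𝓝[>] 0)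
        (𝓝 (D' * ENNReal.ofReal 0 ^ c)) := by
      refine Tendsto.mono_left ?_ nhdsWithin_le_nhds
      exact ENNReal.Tendsto.const_mul ((ENNReal.continuous_rpow_const.comp
        ENNReal.continuous_ofReal).tendsto 0) (Or.inr hD'fin)
    rw [ENNReal.ofReal_zero, ENNReal.zero_rpow_of_pos hc, mul_zero,
      ENNReal.tendsto_nhds_zero] at hsmall
    obtain ⟨δ, hδε, hδ⟩ := ((hsmall _ (ENNReal.ofReal_pos.2 hε)).and self_mem_nhdsWithin).exists
    refine ⟨δ, hδ, fun k A hA hAδ => ?_⟩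
    rw [eLpNorm_indicator_eq_eLpNorm_restrict hA, eLpNorm_one_eq_lintegral_enorm, hfi k A hA]
    refine (hestd k A hA).trans (le_trans ?_ hδε)
    rw [hν, withDensity_apply _ hA] at hAδ
    gcongr
  have hconv := tendsto_Lp_finite_of_tendsto_ae (μ := ν) le_rfl ENNReal.one_ne_top
    (fun k => ((hfm k).mono_ac hac).aestronglyMeasurable) (MemLp.zero' (ε := ℝ)) hui
    (hac.ae_le (huv.mono fun x hx => by
      have h1 : Tendsto (fun k => |u k x - v x| ^ r) atTop (𝓝 0) := by
        have := ((hx.sub_const (v x)).abs.rpow_const (p := r) (Or.inr hr0.le))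
        simpa [hr0.ne'] using this
      simpa [hf] using (h1.mul_const (K x)).div_const (H x)))
  have hconv' : Tendsto (fun k => ∫⁻ x, ‖u k x - v x‖ₑ ^ r * ENNReal.ofReal (K x)) atTop
      (𝓝 0) := by
    refine hconv.congr fun k => ?_
    have := hfi k Set.univ MeasurableSet.univ
    rw [Measure.restrict_univ, Measure.restrict_univ] at this
    rw [← this, eLpNorm_one_eq_lintegral_enorm]
    simp
  have := (ENNReal.continuous_rpow_const (y := 1 / r)).tendsto 0 |>.comp hconv'
  rwa [ENNReal.zero_rpow_of_pos (by positivity)] at this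

/-- The compact embedding follows from the Sobolev inequality and from an estimate of
`∫_A |u|^r K` that is uniformly small on sets where the integral of `H` is small. -/
theorem compactlyEmbedded_of_setLIntegral_le {n : ℕ} (hn : 0 < n) {s p m r : ℝ} (hs : 0 < s)
    (hp : 1 ≤ p) (hpm : p < m) (hr : 1 ≤ r) {K H : E n → ℝ}
    (hK : AEMeasurable K) (hK0 : ∀ x, 0 < K x) (hH : Integrable H) (hH0 : ∀ x, 0 < H x)
    {c : ℝ} (hc : 0 < c) {X : Set (E n → ℝ)} {N : (E n → ℝ) → ℝ≥0∞}
    (hX : ∀ u ∈ X, AEMeasurable u) {C₁ C₂ : ℝ≥0}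
    (hSob : ∀ u ∈ X, (∫⁻ x, ‖u x‖ₑ ^ m) ^ (1 / m) ≤ C₁ * N u)
    (hN : ∀ u ∈ X, gagliardo s p u ≤ N u)
    (hest : ∀ u ∈ X, ∀ A, MeasurableSet A → ∫⁻ x in A, ‖u x‖ₑ ^ r * ENNReal.ofReal (K x) ≤
      (C₂ * N u) ^ r * (∫⁻ x in A, ENNReal.ofReal (H x)) ^ c) :
    CompactlyEmbedded X N r K := by
  have hr0 : 0 < r := by linarith
  have hHfin : ∫⁻ x, ENNReal.ofReal (H x) ≠ ∞ :=
    ((hasFiniteIntegral_iff_ofReal (Eventually.of_forall fun x => (hH0 x).le)).1 hH.2).ne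
  refine ⟨?_, fun u hu ⟨M, hM⟩ => ?_⟩
  · have hfin : ((∫⁻ x, ENNReal.ofReal (H x)) ^ c) ^ (1 / r) ≠ ∞ := by finiteness
    refine ⟨C₂ * (((∫⁻ x, ENNReal.ofReal (H x)) ^ c) ^ (1 / r)).toNNReal, fun u hu => ?_⟩
    rw [wnorm, ENNReal.coe_mul, ENNReal.coe_toNNReal hfin]
    have := ENNReal.rpow_le_rpow (hest u hu Set.univ MeasurableSet.univ)
      (one_div_nonneg.2 hr0.le)
    rw [Measure.restrict_univ, ENNReal.mul_rpow_of_nonneg _ _ (one_div_nonneg.2 hr0.le),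
      ← ENNReal.rpow_mul (C₂ * N u), mul_one_div_cancel hr0.ne', ENNReal.rpow_one] at this
    exact this.trans_eq (by ring)
  · obtain ⟨θ, hθ, v, hv, hlim⟩ := exists_subseq_ae_tendsto hn hs hp hpm
      (fun k => hX _ (hu k)) (B := C₁ * M) (M := M)
      (fun k => (hSob _ (hu k)).trans (by rw [ENNReal.coe_mul]; gcongr; exact hM k))
      (fun k => (hN _ (hu k)).trans (hM k))
    have hD : ((C₂ : ℝ≥0∞) * M) ^ r ≠ ∞ := by finiteness
    obtain ⟨h1, h2⟩ := tendsto_wnorm_of_ae_tendsto hr hK hK0 hH hH0 hc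
      (D := (((C₂ : ℝ≥0∞) * M) ^ r).toNNReal) (u := fun k => u (θ k))
      (fun k => hX _ (hu _)) hv hlim (fun k A hA => by
        rw [ENNReal.coe_toNNReal hD]
        refine (hest _ (hu _) A hA).trans ?_
        gcongr
        exact hM _)
    exact ⟨v, hv, h1, θ, hθ, h2⟩

/-! ### Hölder estimates -/

/-- Hölder's inequality with three factors, for a weight `K = H^c V^a`. -/
theorem setLIntegral_le_mul_mul {n : ℕ} {q m r a b c : ℝ} (ha : 0 ≤ a) (hb : 0 ≤ b) (hc : 0 ≤ c)
    (hq : 0 ≤ q) (hm : 0 ≤ m) (hsum : c + a + b = 1) (hr : q * a + m * b = r)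
    {K V H : E n → ℝ} (hV : AEMeasurable V) (hH : AEMeasurable H)
    (hV0 : ∀ x, 0 < V x) (hH0 : ∀ x, 0 < H x) (hKH : ∀ x, K x = H x ^ c * V x ^ a)
    {u : E n → ℝ} (hu : AEMeasurable u) (A : Set (E n)) :
    ∫⁻ x in A, ‖u x‖ₑ ^ r * ENNReal.ofReal (K x) ≤
      (∫⁻ x in A, ENNReal.ofReal (H x)) ^ c *
        (∫⁻ x, ‖u x‖ₑ ^ q * ENNReal.ofReal (V x)) ^ a * (∫⁻ x, ‖u x‖ₑ ^ m) ^ b := by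
  have h := ENNReal.lintegral_prod_norm_pow_le (μ := volume.restrict A)
    (Finset.univ : Finset (Fin 3))
    (f := ![fun x => ENNReal.ofReal (H x), fun x => ‖u x‖ₑ ^ q * ENNReal.ofReal (V x),
      fun x => ‖u x‖ₑ ^ m]) (p := ![c, a, b])
    (by
      intro i _
      fin_cases i
      · exact hH.ennreal_ofReal.restrict
      · exact (aemeasurable_enorm_rpow_mul hV hu).restrict
      · exact (hu.enorm.pow_const m).restrict)
    (by simpa [Fin.sum_univ_three] using hsum)
    (by intro i _; fin_cases i <;> simpa)
  simp only [Fin.prod_univ_three, Matrix.cons_val] at h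
  calc ∫⁻ x in A, ‖u x‖ₑ ^ r * ENNReal.ofReal (K x)
      = ∫⁻ x in A, ENNReal.ofReal (H x) ^ c * (‖u x‖ₑ ^ q * ENNReal.ofReal (V x)) ^ a *
          (‖u x‖ₑ ^ m) ^ b := by
        refine lintegral_congr fun x => ?_
        rw [hKH, ← hr, ENNReal.rpow_add_of_nonneg _ _ (by positivity) (by positivity),
          ENNReal.ofReal_mul (Real.rpow_nonneg (hH0 x).le _),
          ENNReal.mul_rpow_of_nonneg _ _ ha, ENNReal.ofReal_rpow_of_nonneg (hH0 x).le hc,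
          ENNReal.ofReal_rpow_of_nonneg (hV0 x).le ha, ENNReal.rpow_mul, ENNReal.rpow_mul]
        ring
    _ ≤ _ := h
    _ ≤ _ := by
        gcongr
        · exact Measure.restrict_le_self
        · exact Measure.restrict_le_self

/-- The three-factor Hölder inequality in terms of a norm `N` that dominates both the
`L^q(V)` norm and the `L^m` norm. The former plays no role if its exponent `a` is `0`. -/
theorem setLIntegral_le_norm {n : ℕ} {q m r a b c : ℝ} (ha : 0 ≤ a) (hb : 0 ≤ b) (hc : 0 ≤ c)
    (hq : 0 < q) (hm : 0 < m) (hsum : c + a + b = 1) (hr : q * a + m * b = r)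
    {K V H : E n → ℝ} (hV : AEMeasurable V) (hH : AEMeasurable H)
    (hV0 : ∀ x, 0 < V x) (hH0 : ∀ x, 0 < H x) (hKH : ∀ x, K x = H x ^ c * V x ^ a)
    {u : E n → ℝ} (hu : AEMeasurable u) {N : ℝ≥0∞} {C : ℝ≥0} (hN : a = 0 ∨ wnorm q V u ≤ N)
    (hSob : (∫⁻ x, ‖u x‖ₑ ^ m) ^ (1 / m) ≤ C * N) (A : Set (E n)) :
    ∫⁻ x in A, ‖u x‖ₑ ^ r * ENNReal.ofReal (K x) ≤
      ((max 1 C : ℝ≥0) * N) ^ r * (∫⁻ x in A, ENNReal.ofReal (H x)) ^ c := by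
  have h1 : (∫⁻ x, ‖u x‖ₑ ^ q * ENNReal.ofReal (V x)) ^ a ≤
      ((max 1 C : ℝ≥0) * N) ^ (q * a) := by
    rcases hN with rfl | hN
    · simp
    rw [wnorm, rpow_one_div_le_iff hq] at hN
    rw [ENNReal.rpow_mul]
    gcongr
    refine hN.trans ?_
    gcongr
    calc N = 1 * N := (one_mul N).symm
      _ ≤ _ := by
        gcongr
        exact_mod_cast le_max_left 1 C
  have h2 : (∫⁻ x, ‖u x‖ₑ ^ m) ^ b ≤ ((max 1 C : ℝ≥0) * N) ^ (m * b) := by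
    rw [rpow_one_div_le_iff hm] at hSob
    rw [ENNReal.rpow_mul]
    gcongr
    refine hSob.trans ?_
    gcongr
    exact le_max_right 1 C
  refine (setLIntegral_le_mul_mul ha hb hc hq.le hm.le hsum hr hV hH hV0 hH0 hKH hu A).trans ?_
  rw [← hr, ENNReal.rpow_add_of_nonneg _ _ (by positivity) (by positivity), mul_assoc, mul_comm]
  gcongr

/-- The exponents of the three-factor Hölder inequality: with `c = 1 / ψ(τ)` and `a = τ c`, the
remaining exponent is nonnegative and the powers of `|u|` add up to `r`. -/
theorem psi_exponents {n : ℕ} {s p q r τ : ℝ} (hrm : r < pstar n s p) (hrq : r < q)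
    (hτ0 : 0 ≤ τ) (hτ : τ ≤ r / (q - r)) :
    0 < psi n s p q r τ ∧ 0 ≤ 1 - 1 / psi n s p q r τ - τ * (1 / psi n s p q r τ) ∧
      q * (τ * (1 / psi n s p q r τ)) +
        pstar n s p * (1 - 1 / psi n s p q r τ - τ * (1 / psi n s p q r τ)) = r := by
  set m := pstar n s p with hm
  have hmr : 0 < m - r := by linarith
  have hτ' : τ * (q - r) ≤ r := by rwa [le_div_iff₀ (by linarith)] at hτ
  have hψ : psi n s p q r τ * (m - r) = m + τ * (m - q) := by
    rw [psi, ← hm, div_mul_cancel₀ _ hmr.ne']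
  have h1 : 1 + τ ≤ psi n s p q r τ := by
    rw [psi, ← hm, le_div_iff₀ hmr]; nlinarith
  set ψ := psi n s p q r τ
  have hψ0 : 0 < ψ := by linarith
  refine ⟨hψ0, ?_, ?_⟩
  · have : 1 / ψ * (1 + τ) ≤ 1 := by
      rw [one_div, inv_mul_le_iff₀ hψ0, mul_one]; exact h1
    linarith
  · field_simp
    linarith

end FracSobolev

theorem theorem7 (n : ℕ) (hn : 2 ≤ n) (s p q r : ℝ) (hs0 : 0 < s) (hs1 : s < 1)
    (hp : 1 ≤ p) (hsp : s * p < n) (hr : 1 ≤ r)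
    (hrmin : r < min (FracSobolev.pstar n s p) q)
    (K : FracSobolev.E n → ℝ) (hKmeas : AEMeasurable K) (hKpos : ∀ x, 0 < K x)
    (t : ℝ≥0∞)
    (ht : ENNReal.ofReal
      (max (FracSobolev.pstar n s p) q / (max (FracSobolev.pstar n s p) q - r)) < t)
    (hKloc : FracSobolev.MemLpLoc K t) :
    (∀ V : FracSobolev.E n → ℝ, AEMeasurable V → (∀ x, 0 < V x) →
      (∀ D : Set (FracSobolev.E n), IsCompact D → ∃ c : ℝ, 0 < c ∧ ∀ x ∈ D, c ≤ V x) →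
      ∀ τ : ℝ, 0 ≤ τ → τ ≤ r / (q - r) →
      Integrable (fun x => K x ^ FracSobolev.psi n s p q r τ * V x ^ (-τ)) →
      FracSobolev.CompactlyEmbedded (FracSobolev.spaceMV s q p V)
        (FracSobolev.normMV s q p V) r K) ∧
    (Integrable (fun x => K x ^ (FracSobolev.pstar n s p / (FracSobolev.pstar n s p - r))) →
      FracSobolev.CompactlyEmbedded (FracSobolev.spaceD n s p)
        (FracSobolev.gagliardo s p) r K) := by
  have hn0 : 0 < n := by omega
  have hp0 : 0 < p := by linarith
  have hr0 : 0 < r := by linarith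
  obtain ⟨hrm, hrq⟩ := lt_min_iff.1 hrmin
  have hpm := FracSobolev.lt_pstar hs0 hp0 hsp
  have hm0 : 0 < FracSobolev.pstar n s p := by linarith
  have hq0 : 0 < q := by linarith
  refine ⟨fun V hV hV0 _ τ hτ0 hτ hH => ?_, fun hH => ?_⟩
  · obtain ⟨C, hC⟩ := FracSobolev.exists_sobolev_spaceMV (q := q) hn0 hs0 hp hsp hq0
    obtain ⟨hψ, hb, hsum⟩ := FracSobolev.psi_exponents hrm hrq hτ0 hτ
    have hH0 : ∀ x, 0 < K x ^ FracSobolev.psi n s p q r τ * V x ^ (-τ) := fun x =>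
      mul_pos (Real.rpow_pos_of_pos (hKpos x) _) (Real.rpow_pos_of_pos (hV0 x) _)
    have hSob : ∀ u ∈ FracSobolev.spaceMV s q p V,
        (∫⁻ x, ‖u x‖ₑ ^ FracSobolev.pstar n s p) ^ (1 / FracSobolev.pstar n s p) ≤
          C * FracSobolev.normMV s q p V u := fun u hu =>
      (hC V hV hV0 u hu).trans (by gcongr; exact le_add_self)
    refine FracSobolev.compactlyEmbedded_of_setLIntegral_le hn0 hs0 hp hpm hr hKmeas hKpos hH hH0
      (one_div_pos.2 hψ) (fun u hu => hu.1) hSob (fun u _ => le_add_self) (C₂ := max 1 C)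
      fun u hu A _ => ?_
    refine FracSobolev.setLIntegral_le_norm (mul_nonneg hτ0 (one_div_pos.2 hψ).le) hb
      (one_div_pos.2 hψ).le hq0 hm0 (by ring) hsum hV hH.aemeasurable hV0 hH0 (fun x => ?_) hu.1
      (Or.inr le_self_add) (hSob u hu) A
    rw [Real.mul_rpow (Real.rpow_nonneg (hKpos x).le _) (Real.rpow_nonneg (hV0 x).le _),
      ← Real.rpow_mul (hKpos x).le, mul_one_div_cancel hψ.ne', Real.rpow_one, mul_assoc,
      ← Real.rpow_mul (hV0 x).le, ← Real.rpow_add (hV0 x), neg_mul, neg_add_cancel,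
      Real.rpow_zero, mul_one]
  · obtain ⟨C, hC⟩ := FracSobolev.exists_sobolev hn0 hs0 hp hsp
    have hrm' : 0 < FracSobolev.pstar n s p - r := by linarith
    set m := FracSobolev.pstar n s p
    have hH0 : ∀ x, 0 < K x ^ (m / (m - r)) := fun x => Real.rpow_pos_of_pos (hKpos x) _
    have hSob : ∀ u ∈ FracSobolev.spaceD n s p,
        (∫⁻ x, ‖u x‖ₑ ^ m) ^ (1 / m) ≤ C * FracSobolev.gagliardo s p u := fun u hu =>
      hC u hu.1.aestronglyMeasurable.aemeasurable hu.2.1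
    have hc : 0 < (m - r) / m := by positivity
    refine FracSobolev.compactlyEmbedded_of_setLIntegral_le hn0 hs0 hp hpm hr hKmeas hKpos hH hH0
      hc (fun u hu => hu.1.aestronglyMeasurable.aemeasurable) hSob (fun u _ => le_rfl)
      (C₂ := max 1 C) fun u hu A _ => ?_
    -- the middle factor of the Hölder inequality has exponent `0`, so its weight is immaterial
    refine FracSobolev.setLIntegral_le_norm (q := 1) (a := 0) (b := r / m) (V := fun _ => 1) le_rfl
      (by positivity) hc.le one_pos hm0 (by field_simp; ring) (by field_simp; ring)
      aemeasurable_const hH.aemeasurable (fun _ => one_pos) hH0 (fun x => ?_)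
      hu.1.aestronglyMeasurable.aemeasurable (Or.inl rfl) (hSob u hu) A
    rw [← Real.rpow_mul (hKpos x).le, div_mul_div_cancel₀' hm0.ne', div_self hrm'.ne']
    simp
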